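/- Let $0<\alpha\le 2$ and let $M$ be a symmetric $\alpha$-stable random measure on $\mathbb R$, over a probability space, with control measure Lebesgue measure $\mathcal L$; that is, an independently scattered, $\sigma$-additive random set function on the Borel sets of finite Lebesgue measure such that $M(A)$ has characteristic function $\theta\mapsto \exp(-\mathcal L(A)|\theta|^\alpha)$. Let $\mathcal F_\alpha$ be the set of measurable $f:\mathbb R\to\mathbb R$ with $\int|f(x)|^\alpha dx<\infty$; for $f\in\mathcal F_\alpha$ let $\int f(x)M(dx)$ be the stochastic integral, that is, the limit in probability of the integrals of simple functions that converge to $f$ in $L^\alpha$. Let $g\in\mathcal F_\alpha$ and let $Y$ be the moving average process $$Y(t)=\int g(t-x)\,M(dx)\qquad(t\in\mathbb R).$$ Let $\gamma\in\mathbb R$ with $\gamma+1/\alpha>0$, and suppose that there is a jointly measurable function $h:\mathbb R\times\mathbb R\to\mathbb R$ with $h(t,\cdot)\in\mathcal F_\alpha$ for every $t\in\mathbb R$, such that $h(t,\cdot)$ is not almost everywhere zero for at least one $t$, and such that $$\lim_{r\to0^+}\int\left|\frac{g(r(t+z))-g(rz)}{r^\gamma}-h(t,z)\right|^\alpha dz=0\qquad\text{for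 all }t\in\mathbb R.$$ Then, at every $u\in\mathbb R$, $Y$ is $(\gamma+1/\alpha)$-localisable with local form (tangent process) $Y'_u=\{\int h(t,z)\,M(dz):t\in\mathbb R\}$; that is, $Y'_u$ is non-trivial (for some $t$, $Y'_u(t)$ is not almost surely zero) and, as $r\to0^+$, the finite-dimensional distributions of the process $t\mapsto r^{-(\gamma+1/\alpha)}\bigl(Y(u+rt)-Y(u)\bigr)$ converge to those of $Y'_u$. -/

import Mathlib

open MeasureTheory ProbabilityTheory Filter Topology

noncomputable section

/-- The class `𝓕_α(E, 𝓔, m)`: measurable real functions with `∫ |f|^α dm < ∞`. -/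
def MemFAlpha {E : Type*} [MeasurableSpace E] (α : ℝ) (m : Measure E) (f : E → ℝ) : Prop :=
  Measurable f ∧ ∫⁻ x, ‖f x‖ₑ ^ α ∂m < ⊤

/-- The probability law `ν` is the symmetric `α`-stable law `S_α(σ, 0, 0)`, i.e. its
characteristic function is `θ ↦ exp (-σ^α |θ|^α)`. (For `α = 2` this is `N(0, 2σ²)`.) -/
def IsSymmStableLaw (α σ : ℝ) (ν : Measure ℝ) : Prop :=
  ∀ θ : ℝ, charFun ν θ = ((Real.exp (-(σ ^ α * |θ| ^ α)) : ℝ) : ℂ)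

/-- `M` is a symmetric `α`-stable random measure on `E` with control measure `m`: an
independently scattered, `σ`-additive random set function, defined on the measurable sets of
finite `m`-measure, with `M(A) ∼ S_α(m(A)^{1/α}, 0, 0)`.
(The values of `M` on all other sets are irrelevant.) -/
structure IsSymmStableRandomMeasure {E Ω : Type*} [MeasurableSpace E] [MeasurableSpace Ω]
    (α : ℝ) (m : Measure E) (P : Measure Ω) (M : Set E → Ω → ℝ) : Prop where
  measurable : ∀ A : Set E, MeasurableSet A → m A < ⊤ → Measurable (M A)
  law : ∀ A : Set E, MeasurableSet A → m A < ⊤ →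
    IsSymmStableLaw α ((m A).toReal ^ (1 / α)) (P.map (M A))
  indep : ∀ (n : ℕ) (A : Fin n → Set E), (∀ i, MeasurableSet (A i)) → (∀ i, m (A i) < ⊤) →
    Pairwise (Function.onFun Disjoint A) → iIndepFun (fun i => M (A i)) P
  /-- The series `∑ M(A i)` of a disjoint sequence converges almost surely, as a limit of partial
  sums (it need not converge absolutely), to the value of `M` at the union. -/
  sigma_additive : ∀ A : ℕ → Set E, (∀ i, MeasurableSet (A i)) → m (⋃ i, A i) < ⊤ →
    Pairwise (Function.onFun Disjoint A) →
    ∀ᵐ ω ∂P, Tendsto (fun n => ∑ i ∈ Finset.range n, M (A i) ω) atTop (𝓝 (M (⋃ i, A i) ω))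

/-- The integral `∑ y, y M({φ = y})` of a simple function against a random set function. The
value `y = 0` contributes nothing. -/
def simpleStableIntegral {E Ω : Type*} [MeasurableSpace E]
    (M : Set E → Ω → ℝ) (φ : SimpleFunc E ℝ) (ω : Ω) : ℝ :=
  ∑ y ∈ φ.range, y * M (φ ⁻¹' {y}) ω

/-- The random variable `X` is (a version of) the stochastic integral `∫ f dM`: the limit in
probability of the integrals of simple functions which converge to `f` in `L^α(m)`. -/
def IsStableIntegral {E Ω : Type*} [MeasurableSpace E] [MeasurableSpace Ω]
    (α : ℝ) (m : Measure E) (P : Measure Ω) (M : Set E → Ω → ℝ) (f : E → ℝ) (X : Ω → ℝ) : Prop :=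
  Measurable X ∧ ∃ φ : ℕ → SimpleFunc E ℝ,
    (∀ n, (φ n).FinMeasSupp m) ∧
    Tendsto (fun n => ∫⁻ x, ‖φ n x - f x‖ₑ ^ α ∂m) atTop (𝓝 0) ∧
    TendstoInMeasure P (fun n => simpleStableIntegral M (φ n)) atTop X

open Classical in
/-- The stochastic integral `∫ f dM`, a random variable determined up to almost sure equality
(and `0` by convention if there is no such random variable). -/
def stableIntegral {E Ω : Type*} [MeasurableSpace E] [MeasurableSpace Ω]
    (α : ℝ) (m : Measure E) (P : Measure Ω) (M : Set E → Ω → ℝ) (f : E → ℝ) : Ω → ℝ :=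
  if hX : ∃ X, IsStableIntegral α m P M f X then hX.choose else 0

/-- A process `Z` is non-trivial if it is not (a version of) the zero process. -/
def IsNontrivialProcess {Ω : Type*} [MeasurableSpace Ω] (P : Measure Ω) (Z : ℝ → Ω → ℝ) : Prop :=
  ∃ t : ℝ, ¬ (Z t =ᵐ[P] 0)

/-- The process `Y` is `H`-localisable at `u` with local form (tangent process) `Z`:
`H > 0`, `Z` is non-trivial, and `r^{-H} (Y(u + r t) - Y(u)) → Z(t)` as `r → 0⁺` in the sense of
convergence in distribution of all finite-dimensional marginals. -/
def IsLocalisableAt {Ω Ω' : Type*} [MeasurableSpace Ω] [MeasurableSpace Ω']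
    (P : Measure Ω) [IsProbabilityMeasure P] (P' : Measure Ω') [IsProbabilityMeasure P']
    (H : ℝ) (Y : ℝ → Ω → ℝ) (u : ℝ) (Z : ℝ → Ω' → ℝ) : Prop :=
  0 < H ∧ IsNontrivialProcess P' Z ∧
    ∀ (n : ℕ) (t : Fin n → ℝ),
      TendstoInDistribution
        (fun (r : ℝ) (ω : Ω) (i : Fin n) => r ^ (-H) * (Y (u + r * t i) ω - Y u ω))
        (𝓝[>] (0 : ℝ)) (fun (ω : Ω') (i : Fin n) => Z (t i) ω) (fun _ => P) P'

end

/-!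
A linear combination of stable integrals is the stable integral of the linear combination of the
integrands, and the law of `∫ f dM` depends only on its scale `‖f‖_α`. Hence, by the Cramér–Wold
device, finite-dimensional distributions of stable integrals converge as soon as the scales of all
linear combinations of the integrands do. The reflection `x ↦ u - x` followed by the dilation
`x = r z` multiplies the scale of the integrand of `∑ c_k (Y(u + r t_k) - Y(u))` by `r^{1/α}`, which
is absorbed by the normalisation `r^{-(γ + 1/α)}`; what remains is the scale of
`∑ c_k (g(r(t_k + z)) - g(r z)) / r^γ`, whose limit is that of `∑ c_k h(t_k, z)` by assumption.
-/

open scoped ENNReal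

section Convergence

variable {ι κ : Type*} {l : Filter ι}

lemma tendsto_probabilityMeasure_iff_tendsto_charFun [l.IsCountablyGenerated] {E : Type*}
    [NormedAddCommGroup E] [InnerProductSpace ℝ E] [FiniteDimensional ℝ E] [MeasurableSpace E]
    [BorelSpace E] {μ : ι → ProbabilityMeasure E} {μ₀ : ProbabilityMeasure E} :
    Tendsto μ l (𝓝 μ₀) ↔
      ∀ t : E, Tendsto (fun i => charFun (μ i : Measure E) t) l (𝓝 (charFun μ₀ t)) := by
  refine ⟨fun h t => tendsto_of_seq_tendsto fun u hu => ?_, fun h => tendsto_of_seq_tendsto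
    fun u hu => ProbabilityMeasure.tendsto_of_tendsto_charFun fun t => (h t).comp hu⟩
  exact ProbabilityMeasure.tendsto_iff_tendsto_charFun.1 (h.comp hu) t

lemma charFun_map_toLp [Fintype κ] {Ω : Type*} [MeasurableSpace Ω] {P : Measure Ω}
    {X : Ω → κ → ℝ} (hX : AEMeasurable X P) (θ : EuclideanSpace ℝ κ) :
    charFun (P.map fun ω => WithLp.toLp 2 (X ω)) θ =
      charFun (P.map fun ω => ∑ k, θ k * X ω k) 1 := by
  rw [charFun_apply, charFun_apply, integral_map (by fun_prop) (by fun_prop),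
    integral_map (by fun_prop) (by fun_prop)]
  simp [PiLp.inner_apply]

/-- The Cramér–Wold device. -/
theorem tendstoInDistribution_pi_of_forall_sum [l.IsCountablyGenerated] [Fintype κ]
    {Ω : ι → Type*} [∀ i, MeasurableSpace (Ω i)] {P : ∀ i, Measure (Ω i)}
    [∀ i, IsProbabilityMeasure (P i)] {Ω' : Type*} [MeasurableSpace Ω'] {P' : Measure Ω'}
    [IsProbabilityMeasure P'] {X : ∀ i, Ω i → κ → ℝ} {Z : Ω' → κ → ℝ}
    (h : ∀ c : κ → ℝ, TendstoInDistribution (fun i ω => ∑ k, c k * X i ω k) l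
      (fun ω => ∑ k, c k * Z ω k) P P') :
    TendstoInDistribution X l Z P P' := by
  classical
  have hX (i) : AEMeasurable (X i) (P i) := aemeasurable_pi_lambda _ fun k => by
    simpa [Pi.single_apply] using (h (Pi.single k 1)).forall_aemeasurable i
  have hZ : AEMeasurable Z P' := aemeasurable_pi_lambda _ fun k => by
    simpa [Pi.single_apply] using (h (Pi.single k 1)).aemeasurable_limit
  suffices TendstoInDistribution (fun i ω => WithLp.toLp 2 (X i ω)) l
      (fun ω => WithLp.toLp 2 (Z ω)) P P' from
    this.continuous_comp (g := fun x : EuclideanSpace ℝ κ => x.ofLp) (PiLp.continuous_ofLp 2 _)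
  refine ⟨fun i => by fun_prop, by fun_prop, ?_⟩
  refine tendsto_probabilityMeasure_iff_tendsto_charFun.2 fun θ => ?_
  simp only [ProbabilityMeasure.coe_mk, charFun_map_toLp (hX _), charFun_map_toLp hZ]
  exact tendsto_probabilityMeasure_iff_tendsto_charFun.1 (h θ).tendsto 1

theorem tendstoInMeasure_of_tendstoInDistribution_const {Ω Ω' E : Type*}
    [MeasurableSpace Ω] [MeasurableSpace Ω'] {P : Measure Ω} [IsProbabilityMeasure P]
    {P' : Measure Ω'} [IsProbabilityMeasure P'] [PseudoEMetricSpace E] [MeasurableSpace E]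
    [OpensMeasurableSpace E] {X : ι → Ω → E} {c : E}
    (h : TendstoInDistribution X l (fun _ => c) (fun _ => P) P') :
    TendstoInMeasure P X l fun _ => c := by
  intro ε hε
  have hF : IsClosed {x : E | ε ≤ edist x c} := isClosed_le continuous_const (by fun_prop)
  have hlim := ProbabilityMeasure.limsup_measure_closed_le_of_tendsto h.tendsto hF
  simp only [ProbabilityMeasure.coe_mk, Measure.map_const, measure_univ, one_smul,
    Measure.dirac_apply' c hF.measurableSet, Set.mem_ofPred_eq, edist_self, not_le.2 hε,
    not_false_eq_true, Set.indicator_of_notMem,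
    Measure.map_apply_of_aemeasurable (h.forall_aemeasurable _) hF.measurableSet] at hlim
  exact tendsto_of_le_liminf_of_limsup_le zero_le hlim

theorem exists_seq_ae_tendsto_of_tendstoInMeasure_sub {Ω E : Type*} [MeasurableSpace Ω]
    {μ : Measure Ω} [NormedAddCommGroup E] [CompleteSpace E] {X : ℕ → Ω → E}
    (h : TendstoInMeasure μ (fun p : ℕ × ℕ => X p.1 - X p.2) atTop 0) :
    ∃ ns : ℕ → ℕ, StrictMono ns ∧
      ∀ᵐ ω ∂μ, ∃ x, Tendsto (fun k => X (ns k) ω) atTop (𝓝 x) := by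
  have hsmall (k : ℕ) : ∃ N, ∀ i ≥ N, ∀ j ≥ i,
      μ {ω | (1 / 2) ^ k ≤ ‖(X j - X i) ω‖} ≤ 2⁻¹ ^ k := by
    obtain ⟨N, hN⟩ := eventually_atTop_prod_self'.1 <|
      (tendstoInMeasure_iff_norm.1 h ((1 / 2) ^ k) (by positivity)).eventually_le_const
        (u := 2⁻¹ ^ k) (by simp [pos_iff_ne_zero])
    exact ⟨N, fun i hi j hij => by simpa using hN j (hi.trans hij) i hi⟩
  obtain ⟨ns, hns, hμ⟩ := extraction_forall_of_eventually' hsmall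
  refine ⟨ns, hns, ?_⟩
  have hsum : ∑' k, μ {ω | (1 / 2) ^ k ≤ ‖(X (ns (k + 1)) - X (ns k)) ω‖} ≠ ∞ :=
    ne_top_of_le_ne_top (by simp [ENNReal.tsum_geometric])
      (ENNReal.tsum_le_tsum fun k => hμ k _ (hns.monotone k.le_succ))
  filter_upwards [ae_eventually_notMem hsum] with ω hω
  refine cauchySeq_tendsto_of_complete (cauchySeq_of_summable_dist ?_)
  refine summable_geometric_two.of_norm_bounded_eventually_nat ?_
  filter_upwards [hω] with k hk
  rw [Real.norm_eq_abs, abs_dist, dist_comm, dist_eq_norm]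
  exact (not_le.1 hk).le

end Convergence

section LpSeminorm

variable {E F ι : Type*} [MeasurableSpace E] {m : Measure E} [NormedAddCommGroup F] {l : Filter ι}
  {p : ℝ≥0∞}

/-- For `p < 1` the `p`-th power of `eLpNorm` is subadditive although `eLpNorm` is not. -/
lemma eLpNorm_add_rpow_le {f g : E → F} (hf : AEStronglyMeasurable f m)
    (hg : AEStronglyMeasurable g m) :
    eLpNorm (f + g) p m ^ (min 1 p).toReal ≤
      eLpNorm f p m ^ (min 1 p).toReal + eLpNorm g p m ^ (min 1 p).toReal := by
  rcases le_total 1 p with hp | hp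
  · simpa [hp] using eLpNorm_add_le hf hg hp
  rcases eq_or_ne p 0 with rfl | hp0
  · simp
  have hp_top : p ≠ ∞ := ne_top_of_le_ne_top ENNReal.one_ne_top hp
  have hp_pos : 0 < p.toReal := ENNReal.toReal_pos hp0 hp_top
  simp only [min_eq_right hp, eLpNorm_eq_lintegral_rpow_enorm_toReal hp0 hp_top, one_div,
    ENNReal.rpow_inv_rpow hp_pos.ne']
  rw [← lintegral_add_left' (by fun_prop)]
  gcongr with x
  exact (ENNReal.rpow_le_rpow (enorm_add_le _ _) hp_pos.le).trans
    (ENNReal.rpow_add_le_add_rpow _ _ hp_pos.le (ENNReal.toReal_mono ENNReal.one_ne_top hp))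

lemma tendsto_eLpNorm_of_tendsto_eLpNorm_sub {f : ι → E → F} {f₀ : E → F}
    (hf : ∀ i, AEStronglyMeasurable (f i) m) (hf₀ : MemLp f₀ p m)
    (h : Tendsto (fun i => eLpNorm (f i - f₀) p m) l (𝓝 0)) :
    Tendsto (fun i => eLpNorm (f i) p m) l (𝓝 (eLpNorm f₀ p m)) := by
  rcases eq_or_ne p 0 with rfl | hp0
  · simp [tendsto_const_nhds]
  set q := (min 1 p).toReal
  have hq : 0 < q := ENNReal.toReal_pos (by simp [hp0]) (by simp)
  have hdiff : Tendsto (fun i => eLpNorm (f i - f₀) p m ^ q) l (𝓝 0) := by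
    simpa [hq] using h.ennrpow_const q
  have hfin : eLpNorm f₀ p m ^ q ≠ ∞ := ENNReal.rpow_ne_top_of_nonneg hq.le hf₀.2.ne
  suffices Tendsto (fun i => eLpNorm (f i) p m ^ q) l (𝓝 (eLpNorm f₀ p m ^ q)) by
    simpa [ENNReal.rpow_rpow_inv hq.ne'] using this.ennrpow_const q⁻¹
  refine tendsto_of_tendsto_of_tendsto_of_le_of_le
    (g := fun i => eLpNorm f₀ p m ^ q - eLpNorm (f i - f₀) p m ^ q)
    (h := fun i => eLpNorm (f i - f₀) p m ^ q + eLpNorm f₀ p m ^ q) ?_ ?_ (fun i => ?_) fun i => ?_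
  · simpa using ENNReal.Tendsto.sub tendsto_const_nhds hdiff (Or.inl hfin)
  · simpa using hdiff.add_const (eLpNorm f₀ p m ^ q)
  · rw [tsub_le_iff_left, eLpNorm_sub_comm]
    simpa using eLpNorm_add_rpow_le (p := p) (hf₀.1.sub (hf i)) (hf i)
  · simpa using eLpNorm_add_rpow_le (p := p) ((hf i).sub hf₀.1) hf₀.1

lemma tendsto_eLpNorm_add_zero {f g : ι → E → F} (hf : ∀ i, AEStronglyMeasurable (f i) m)
    (hg : ∀ i, AEStronglyMeasurable (g i) m) (hf₀ : Tendsto (fun i => eLpNorm (f i) p m) l (𝓝 0))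
    (hg₀ : Tendsto (fun i => eLpNorm (g i) p m) l (𝓝 0)) :
    Tendsto (fun i => eLpNorm (f i + g i) p m) l (𝓝 0) := by
  have hbound : Tendsto
      (fun i => ENNReal.LpAddConst p * (eLpNorm (f i) p m + eLpNorm (g i) p m)) l (𝓝 0) := by
    simpa using ENNReal.Tendsto.const_mul (hf₀.add hg₀) (Or.inr (ENNReal.LpAddConst_lt_top p).ne)
  exact tendsto_of_tendsto_of_tendsto_of_le_of_le tendsto_const_nhds hbound
    (fun _ => zero_le) fun i => eLpNorm_add_le' (hf i) (hg i) p

lemma tendsto_eLpNorm_sum_zero {κ : Type*} (s : Finset κ) {f : κ → ι → E → F}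
    (hf : ∀ k i, AEStronglyMeasurable (f k i) m)
    (hf₀ : ∀ k, Tendsto (fun i => eLpNorm (f k i) p m) l (𝓝 0)) :
    Tendsto (fun i => eLpNorm (∑ k ∈ s, f k i) p m) l (𝓝 0) := by
  classical
  induction s using Finset.induction_on with
  | empty => simp [tendsto_const_nhds]
  | insert a s ha ih =>
    simp only [Finset.sum_insert ha]
    exact tendsto_eLpNorm_add_zero (hf a)
      (fun i => Finset.aestronglyMeasurable_sum s fun k _ => hf k i) (hf₀ a) ih

lemma tendsto_eLpNorm_const_smul_zero {𝕜 : Type*} [NormedField 𝕜] [NormedSpace 𝕜 F] (c : 𝕜)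
    {f : ι → E → F} (hf₀ : Tendsto (fun i => eLpNorm (f i) p m) l (𝓝 0)) :
    Tendsto (fun i => eLpNorm (c • f i) p m) l (𝓝 0) := by
  simpa [eLpNorm_const_smul] using ENNReal.Tendsto.const_mul hf₀ (Or.inr (by simp))

lemma eLpNorm_comp_mul_left (hp : p ≠ ∞) (f : ℝ → F) {r : ℝ} (hr : r ≠ 0) :
    eLpNorm (fun x => f (r * x)) p volume =
      ENNReal.ofReal |r⁻¹| ^ (1 / p).toReal * eLpNorm f p volume := by
  rw [← smul_eq_mul, ← eLpNorm_smul_measure_of_ne_top hp, ← Real.map_volume_mul_left hr]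
  exact ((Homeomorph.mulLeft₀ r hr).measurableEmbedding.eLpNorm_map_measure).symm

end LpSeminorm

section StableLaw

variable {Ω ι : Type*} [MeasurableSpace Ω] {P : Measure Ω} {α : ℝ}

lemma IsSymmStableLaw.const_mul {X : Ω → ℝ} {σ : ℝ} (h : IsSymmStableLaw α σ (P.map X))
    (hX : AEMeasurable X P) (hσ : 0 ≤ σ) (c : ℝ) :
    IsSymmStableLaw α (|c| * σ) (P.map fun ω => c * X ω) := fun θ => by
  rw [charFun_map_mul_comp hX, h, abs_mul, Real.mul_rpow (abs_nonneg c) (abs_nonneg θ),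
    Real.mul_rpow (abs_nonneg c) hσ]
  congr 3
  ring

lemma IsSymmStableLaw.fun_sum [Fintype ι] {X : ι → Ω → ℝ} {σ : ι → ℝ} {τ : ℝ}
    (h : ∀ i, IsSymmStableLaw α (σ i) (P.map (X i))) (hX : ∀ i, AEMeasurable (X i) P)
    (hindep : iIndepFun X P) (hτ : τ ^ α = ∑ i, σ i ^ α) :
    IsSymmStableLaw α τ (P.map fun ω => ∑ i, X i ω) := fun θ => by
  simp only [hindep.charFun_map_fun_sum_eq_prod hX, Finset.prod_apply, h _ θ]
  rw [← Complex.ofReal_prod, ← Real.exp_sum, Finset.sum_neg_distrib, ← Finset.sum_mul, hτ]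

lemma IsSymmStableLaw.scale_unique {ν : Measure ℝ} {σ τ : ℝ} (hα : α ≠ 0)
    (hσ : 0 ≤ σ) (hτ : 0 ≤ τ)
    (h : IsSymmStableLaw α σ ν) (h' : IsSymmStableLaw α τ ν) : σ = τ := by
  have := (h 1).symm.trans (h' 1)
  rw [Complex.ofReal_inj, Real.exp_eq_exp] at this
  simpa [Real.rpow_left_inj hσ hτ hα] using this

lemma IsSymmStableLaw.tendsto_charFun {l : Filter ι} (hα : 0 < α) {ν : ι → Measure ℝ}
    {σ : ι → ℝ} {τ : ℝ} (h : ∀ i, IsSymmStableLaw α (σ i) (ν i)) (hσ : Tendsto σ l (𝓝 τ))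
    (θ : ℝ) : Tendsto (fun i => charFun (ν i) θ) l (𝓝 (Real.exp (-(τ ^ α * |θ| ^ α)) : ℝ)) := by
  simp only [h _ θ]
  exact (Complex.continuous_ofReal.comp Real.continuous_exp).continuousAt.tendsto.comp
    ((hσ.rpow_const (Or.inr hα.le)).mul_const _).neg

variable [IsProbabilityMeasure P]

lemma IsSymmStableLaw.zero (hα : α ≠ 0) : IsSymmStableLaw α 0 (P.map 0) := fun θ => by
  rw [Pi.zero_def, Measure.map_const]
  simp [hα]

lemma IsSymmStableLaw.tendstoInDistribution {Ω' : Type*} [MeasurableSpace Ω'] {P' : Measure Ω'}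
    [IsProbabilityMeasure P'] {l : Filter ι} [l.IsCountablyGenerated] (hα : 0 < α)
    {X : ι → Ω → ℝ} {Z : Ω' → ℝ} {σ : ι → ℝ} {τ : ℝ}
    (hX : ∀ i, AEMeasurable (X i) P) (hZ : AEMeasurable Z P')
    (hlX : ∀ i, IsSymmStableLaw α (σ i) (P.map (X i))) (hlZ : IsSymmStableLaw α τ (P'.map Z))
    (hσ : Tendsto σ l (𝓝 τ)) : TendstoInDistribution X l Z (fun _ => P) P' := by
  refine ⟨hX, hZ, tendsto_probabilityMeasure_iff_tendsto_charFun.2 fun θ => ?_⟩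
  simpa [hlZ θ] using IsSymmStableLaw.tendsto_charFun hα hlX hσ θ

lemma IsSymmStableLaw.tendstoInMeasure_zero {l : Filter ι} [l.IsCountablyGenerated] (hα : 0 < α)
    {X : ι → Ω → ℝ} {σ : ι → ℝ} (hX : ∀ i, AEMeasurable (X i) P)
    (hlX : ∀ i, IsSymmStableLaw α (σ i) (P.map (X i))) (hσ : Tendsto σ l (𝓝 0)) :
    TendstoInMeasure P X l 0 :=
  tendstoInMeasure_of_tendstoInDistribution_const (P' := P) <|
    IsSymmStableLaw.tendstoInDistribution hα hX aemeasurable_const hlX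
      (IsSymmStableLaw.zero hα.ne') hσ

lemma IsSymmStableLaw.of_tendstoInMeasure {l : Filter ι} [l.IsCountablyGenerated] [l.NeBot]
    (hα : 0 < α) {X : ι → Ω → ℝ} {Z : Ω → ℝ} {σ : ι → ℝ} {τ : ℝ} (hX : ∀ i, AEMeasurable (X i) P)
    (hlX : ∀ i, IsSymmStableLaw α (σ i) (P.map (X i))) (hσ : Tendsto σ l (𝓝 τ))
    (hXZ : TendstoInMeasure P X l Z) :
    IsSymmStableLaw α τ (P.map Z) := fun θ =>
  tendsto_nhds_unique (tendsto_probabilityMeasure_iff_tendsto_charFun.1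
    (hXZ.tendstoInDistribution hX).tendsto θ) (IsSymmStableLaw.tendsto_charFun hα hlX hσ θ)

end StableLaw

section Scale

variable {E : Type*} [MeasurableSpace E] {m : Measure E} {α : ℝ}

/-- The scale parameter `(∫ |f|^α dm)^{1/α}` of the stable random variable `∫ f dM`. -/
noncomputable def stableScale (α : ℝ) (m : Measure E) (f : E → ℝ) : ℝ :=
  (eLpNorm f (ENNReal.ofReal α) m).toReal

lemma stableScale_nonneg {f : E → ℝ} : 0 ≤ stableScale α m f := ENNReal.toReal_nonneg

lemma stableScale_const_smul (c : ℝ) (f : E → ℝ) :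
    stableScale α m (c • f) = |c| * stableScale α m f := by
  rw [stableScale, eLpNorm_const_smul, ENNReal.toReal_mul, toReal_enorm, Real.norm_eq_abs,
    stableScale]

lemma lintegral_enorm_rpow_eq_eLpNorm_rpow (hα : 0 < α) (f : E → ℝ) :
    ∫⁻ x, ‖f x‖ₑ ^ α ∂m = eLpNorm f (ENNReal.ofReal α) m ^ α := by
  rw [eLpNorm_eq_lintegral_rpow_enorm_toReal (by simpa using hα) ENNReal.ofReal_ne_top,
    ENNReal.toReal_ofReal hα.le, one_div, ENNReal.rpow_inv_rpow hα.ne']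

lemma tendsto_lintegral_enorm_rpow_zero_iff (hα : 0 < α) {ι : Type*} {l : Filter ι}
    {f : ι → E → ℝ} :
    Tendsto (fun i => ∫⁻ x, ‖f i x‖ₑ ^ α ∂m) l (𝓝 0) ↔
      Tendsto (fun i => eLpNorm (f i) (ENNReal.ofReal α) m) l (𝓝 0) := by
  simp only [lintegral_enorm_rpow_eq_eLpNorm_rpow hα]
  refine ⟨fun h => ?_, fun h => ?_⟩
  · simpa [ENNReal.rpow_rpow_inv hα.ne', hα] using h.ennrpow_const α⁻¹
  · simpa [hα] using h.ennrpow_const α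

lemma memFAlpha_iff (hα : 0 < α) {f : E → ℝ} :
    MemFAlpha α m f ↔ Measurable f ∧ MemLp f (ENNReal.ofReal α) m := by
  rw [MemFAlpha, lintegral_enorm_rpow_eq_eLpNorm_rpow hα, ENNReal.rpow_lt_top_iff_of_pos hα]
  exact and_congr_right fun hf => (and_iff_right hf.aestronglyMeasurable).symm

lemma MemFAlpha.memLp (hα : 0 < α) {f : E → ℝ} (hf : MemFAlpha α m f) :
    MemLp f (ENNReal.ofReal α) m :=
  ((memFAlpha_iff hα).1 hf).2

lemma MemFAlpha.smul_add_smul (hα : 0 < α) {f g : E → ℝ} (hf : MemFAlpha α m f)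
    (hg : MemFAlpha α m g) (a b : ℝ) : MemFAlpha α m (a • f + b • g) :=
  (memFAlpha_iff hα).2 ⟨(hf.1.const_smul a).add (hg.1.const_smul b),
    ((hf.memLp hα).const_smul a).add ((hg.memLp hα).const_smul b)⟩

lemma MemFAlpha.sum_smul (hα : 0 < α) {ι : Type*} (s : Finset ι) {f : ι → E → ℝ}
    (hf : ∀ i, MemFAlpha α m (f i)) (c : ι → ℝ) : MemFAlpha α m (∑ i ∈ s, c i • f i) :=
  (memFAlpha_iff hα).2 ⟨by have := fun i => (hf i).1; fun_prop,
    memLp_finsetSum' _ fun i _ => ((hf i).memLp hα).const_smul (c i)⟩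

lemma ae_eq_zero_of_stableScale_eq_zero (hα : 0 < α) {f : E → ℝ} (hf : MemFAlpha α m f)
    (h : stableScale α m f = 0) : f =ᵐ[m] 0 :=
  (eLpNorm_eq_zero_iff hf.1.aestronglyMeasurable (by simpa using hα)).1 <|
    ((ENNReal.toReal_eq_zero_iff _).1 h).resolve_right (hf.memLp hα).2.ne

lemma tendsto_stableScale_of_tendsto_eLpNorm_sub (hα : 0 < α) {ι : Type*} {l : Filter ι}
    {f : ι → E → ℝ} {f₀ : E → ℝ} (hf : ∀ i, Measurable (f i)) (hf₀ : MemFAlpha α m f₀)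
    (h : Tendsto (fun i => eLpNorm (f i - f₀) (ENNReal.ofReal α) m) l (𝓝 0)) :
    Tendsto (fun i => stableScale α m (f i)) l (𝓝 (stableScale α m f₀)) :=
  (ENNReal.tendsto_toReal (hf₀.memLp hα).2.ne).comp <| tendsto_eLpNorm_of_tendsto_eLpNorm_sub
    (fun i => (hf i).aestronglyMeasurable) (hf₀.memLp hα) h

lemma MemFAlpha.exists_simpleFunc_tendsto (hα : 0 < α) {f : E → ℝ} (hf : MemFAlpha α m f) :
    ∃ φ : ℕ → SimpleFunc E ℝ, (∀ n, (φ n).FinMeasSupp m) ∧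
      Tendsto (fun n => eLpNorm (⇑(φ n) - f) (ENNReal.ofReal α) m) atTop (𝓝 0) :=
  ⟨fun n => SimpleFunc.approxOn f hf.1 (Set.range f ∪ {0}) 0 (by simp) n,
    fun n => (SimpleFunc.memLp_iff_finMeasSupp (by simpa using hα) ENNReal.ofReal_ne_top).1
      (SimpleFunc.memLp_approxOn_range hf.1 (hf.memLp hα) n),
    SimpleFunc.tendsto_approxOn_range_Lp_eLpNorm ENNReal.ofReal_ne_top hf.1 (hf.memLp hα).2⟩

lemma stableScale_simpleFunc_rpow (hα : 0 < α) {φ : SimpleFunc E ℝ} (hφ : φ.FinMeasSupp m) :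
    stableScale α m φ ^ α = ∑ y ∈ φ.range with y ≠ 0, |y| ^ α * m.real (φ ⁻¹' {y}) := by
  have hlint : ∫⁻ x, ‖φ x‖ₑ ^ α ∂m = ∑ y ∈ φ.range with y ≠ 0, ‖y‖ₑ ^ α * m (φ ⁻¹' {y}) := by
    rw [Finset.sum_filter_of_ne fun y _ hy => by rintro rfl; simp [hα] at hy,
      ← SimpleFunc.map_lintegral (fun y => ‖y‖ₑ ^ α), ← SimpleFunc.lintegral_eq_lintegral]
    rfl
  rw [stableScale, ENNReal.toReal_rpow, ← lintegral_enorm_rpow_eq_eLpNorm_rpow hα, hlint,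
    ENNReal.toReal_sum fun y hy => ENNReal.mul_ne_top
      (ENNReal.rpow_ne_top_of_nonneg hα.le enorm_ne_top)
      (hφ.meas_preimage_singleton_ne_zero (Finset.mem_filter.1 hy).2).ne]
  simp [← ENNReal.toReal_rpow, Measure.real]

end Scale

section SimpleIntegral

variable {E Ω : Type*} [MeasurableSpace E] {M : Set E → Ω → ℝ}

lemma simpleStableIntegral_eq_sum_ne_zero (φ : SimpleFunc E ℝ) (ω : Ω) :
    simpleStableIntegral M φ ω = ∑ y ∈ φ.range with y ≠ 0, y * M (φ ⁻¹' {y}) ω :=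
  (Finset.sum_filter_of_ne fun _ _ hy => left_ne_zero_of_mul hy).symm

variable [MeasurableSpace Ω] {α : ℝ} {m : Measure E} {P : Measure Ω}

lemma IsSymmStableRandomMeasure.iIndepFun {ι : Type*} [Finite ι]
    (hM : IsSymmStableRandomMeasure α m P M) {A : ι → Set E} (hA : ∀ i, MeasurableSet (A i))
    (hmA : ∀ i, m (A i) < ⊤) (hdisj : Pairwise (Function.onFun Disjoint A)) :
    iIndepFun (fun i => M (A i)) P := by
  have e := Finite.equivFin ι
  simpa using (hM.indep _ (A ∘ e.symm) (fun _ => hA _) (fun _ => hmA _)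
    (hdisj.comp_of_injective e.symm.injective)).precomp e.injective

lemma IsSymmStableRandomMeasure.ae_empty (hM : IsSymmStableRandomMeasure α m P M) :
    ∀ᵐ ω ∂P, M ∅ ω = 0 := by
  filter_upwards [hM.sigma_additive (fun _ => ∅) (fun _ => .empty) (by simp)
    (fun _ _ _ => disjoint_bot_left)] with ω hω
  simp only [Finset.sum_const, Finset.card_range, Set.iUnion_empty, nsmul_eq_mul] at hω
  -- the increments `(n + 1) M(∅) - n M(∅)` of a convergent sequence tend to `0`
  have hdiff := (hω.comp (tendsto_add_atTop_nat 1)).sub hω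
  simp only [Function.comp_def, Nat.cast_add_one, add_one_mul, add_sub_cancel_left,
    sub_self] at hdiff
  exact tendsto_nhds_unique tendsto_const_nhds hdiff

lemma IsSymmStableRandomMeasure.ae_union (hM : IsSymmStableRandomMeasure α m P M) {A B : Set E}
    (hA : MeasurableSet A) (hB : MeasurableSet B) (hmA : m A < ⊤) (hmB : m B < ⊤)
    (hAB : Disjoint A B) : ∀ᵐ ω ∂P, M (A ∪ B) ω = M A ω + M B ω := by
  let C : ℕ → Set E
    | 0 => A
    | 1 => B
    | _ => ∅
  have hC : ⋃ n, C n = A ∪ B := by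
    refine subset_antisymm (Set.iUnion_subset ?_)
      (Set.union_subset (Set.subset_iUnion C 0) (Set.subset_iUnion C 1))
    rintro (_ | _ | n) <;> simp [C]
  have hC_meas : ∀ n, MeasurableSet (C n) := by
    rintro (_ | _ | n) <;> simp [C, hA, hB]
  have hC_disj : Pairwise (Function.onFun Disjoint C) := by
    rintro (_ | _ | i) (_ | _ | j) hij <;> simp_all [C, Function.onFun, hAB.symm]
  filter_upwards [hM.sigma_additive C hC_meas (hC ▸ measure_union_lt_top hmA hmB) hC_disj,
    hM.ae_empty] with ω hω hω_empty
  have hsum : ∀ n ≥ 2, ∑ i ∈ Finset.range n, M (C i) ω = M A ω + M B ω := fun n hn => by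
    have hω_ge_two : ∀ i ≥ 2, M (C i) ω = 0 := fun i hi => by
      obtain ⟨k, rfl⟩ := Nat.exists_eq_add_of_le' hi
      exact hω_empty
    rw [Finset.eventually_constant_sum hω_ge_two hn, Finset.sum_range_succ, Finset.sum_range_one]
    rfl
  exact hC ▸ tendsto_nhds_unique hω (tendsto_atTop_of_eventually_const hsum)

lemma IsSymmStableRandomMeasure.ae_biUnion (hM : IsSymmStableRandomMeasure α m P M) {ι : Type*}
    (s : Finset ι) {A : ι → Set E} (hA : ∀ i ∈ s, MeasurableSet (A i))
    (hmA : ∀ i ∈ s, m (A i) < ⊤) (hdisj : (s : Set ι).PairwiseDisjoint A) :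
    ∀ᵐ ω ∂P, M (⋃ i ∈ s, A i) ω = ∑ i ∈ s, M (A i) ω := by
  classical
  induction s using Finset.induction_on with
  | empty => simpa using hM.ae_empty
  | insert a s ha ih =>
    rw [Finset.forall_mem_insert] at hA hmA
    have hdisj_a : Disjoint (A a) (⋃ i ∈ s, A i) := Set.disjoint_iUnion₂_right.2 fun i hi =>
      hdisj (by simp) (by simp [hi]) fun h => ha (h ▸ hi)
    filter_upwards [ih hA.2 hmA.2 (hdisj.subset (by simp)),
      hM.ae_union hA.1 (s.measurableSet_biUnion hA.2) hmA.1
        (measure_biUnion_lt_top s.finite_toSet hmA.2) hdisj_a] with ω hω_s hω_a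
    rw [Finset.set_biUnion_insert, Finset.sum_insert ha, hω_a, hω_s]

lemma simpleStableIntegral_map {G : Type*} [Zero G] (hM : IsSymmStableRandomMeasure α m P M)
    {χ : SimpleFunc E G} (hχ : χ.FinMeasSupp m) {F : G → ℝ} (hF : F 0 = 0) :
    ∀ᵐ ω ∂P, simpleStableIntegral M (χ.map F) ω = ∑ p ∈ χ.range, F p * M (χ ⁻¹' {p}) ω := by
  classical
  have hlevel : ∀ y ∈ (χ.map F).range, ∀ᵐ ω ∂P, y * M (χ.map F ⁻¹' {y}) ω =
      ∑ p ∈ χ.range with F p = y, F p * M (χ ⁻¹' {p}) ω := by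
    intro y _
    have hsum (ω : Ω) : ∑ p ∈ χ.range with F p = y, F p * M (χ ⁻¹' {p}) ω =
        y * ∑ p ∈ χ.range with F p = y, M (χ ⁻¹' {p}) ω := by
      rw [Finset.mul_sum]
      exact Finset.sum_congr rfl fun p hp => by rw [(Finset.mem_filter.1 hp).2]
    simp only [hsum]
    rcases eq_or_ne y 0 with rfl | hy
    · simp
    have hfin : ∀ p ∈ χ.range.filter (F · = y), m (χ ⁻¹' {p}) < ⊤ := fun p hp =>
      hχ.meas_preimage_singleton_ne_zero fun hp0 => hy <| by
        rw [← (Finset.mem_filter.1 hp).2, hp0, hF]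
    have hunion : χ.map F ⁻¹' {y} = ⋃ p ∈ χ.range.filter (F · = y), χ ⁻¹' {p} := by
      ext x
      simp
    filter_upwards [hM.ae_biUnion _ (fun p _ => χ.measurableSet_fiber p) hfin
      (Set.pairwiseDisjoint_fiber χ _)] with ω hω
    rw [hunion, hω]
  filter_upwards [(Finset.eventually_all _).2 hlevel] with ω hω
  rw [simpleStableIntegral, Finset.sum_congr rfl hω, SimpleFunc.range_map]
  exact Finset.sum_fiberwise_of_maps_to (fun p hp => Finset.mem_image_of_mem F hp) _

lemma finMeasSupp_smul_add_smul {φ ψ : SimpleFunc E ℝ} (hφ : φ.FinMeasSupp m)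
    (hψ : ψ.FinMeasSupp m) (a b : ℝ) : (a • φ + b • ψ).FinMeasSupp m :=
  (hφ.pair hψ).map (g := fun p : ℝ × ℝ => a • p.1 + b • p.2) (by simp)

lemma simpleStableIntegral_smul_add_smul (hM : IsSymmStableRandomMeasure α m P M)
    {φ ψ : SimpleFunc E ℝ} (hφ : φ.FinMeasSupp m) (hψ : ψ.FinMeasSupp m) (a b : ℝ) :
    simpleStableIntegral M (a • φ + b • ψ) =ᵐ[P]
      a • simpleStableIntegral M φ + b • simpleStableIntegral M ψ := by
  have hφψ := hφ.pair hψ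
  filter_upwards [simpleStableIntegral_map hM hφψ (F := fun p => a • p.1 + b • p.2) (by simp),
    simpleStableIntegral_map hM hφψ (F := Prod.fst) rfl,
    simpleStableIntegral_map hM hφψ (F := Prod.snd) rfl] with ω hω hω_fst hω_snd
  have hfst : (φ.pair ψ).map Prod.fst = φ := rfl
  have hsnd : (φ.pair ψ).map Prod.snd = ψ := rfl
  rw [hfst] at hω_fst
  rw [hsnd] at hω_snd
  have hmap : (φ.pair ψ).map (fun p => a • p.1 + b • p.2) = a • φ + b • ψ := rfl
  rw [← hmap, hω, Pi.add_apply, Pi.smul_apply, Pi.smul_apply, hω_fst, hω_snd, Finset.smul_sum,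
    Finset.smul_sum, ← Finset.sum_add_distrib]
  exact Finset.sum_congr rfl fun p _ => by simp only [smul_eq_mul]; ring

lemma measurable_simpleStableIntegral (hM : IsSymmStableRandomMeasure α m P M)
    {φ : SimpleFunc E ℝ} (hφ : φ.FinMeasSupp m) : Measurable (simpleStableIntegral M φ) := by
  simp only [funext (simpleStableIntegral_eq_sum_ne_zero (M := M) φ)]
  exact Finset.measurable_sum _ fun y hy => (hM.measurable _ (φ.measurableSet_fiber y)
    (hφ.meas_preimage_singleton_ne_zero (Finset.mem_filter.1 hy).2)).const_mul y

lemma isSymmStableLaw_simpleStableIntegral (hα : 0 < α) (hM : IsSymmStableRandomMeasure α m P M)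
    {φ : SimpleFunc E ℝ} (hφ : φ.FinMeasSupp m) :
    IsSymmStableLaw α (stableScale α m φ) (P.map (simpleStableIntegral M φ)) := by
  let s := φ.range.filter (· ≠ 0)
  have hfin (y : s) : m (φ ⁻¹' {(y : ℝ)}) < ⊤ :=
    hφ.meas_preimage_singleton_ne_zero (Finset.mem_filter.1 y.2).2
  have hmeas (y : s) := (hM.measurable _ (φ.measurableSet_fiber y) (hfin y)).aemeasurable (μ := P)
  have hlaw (y : s) := (hM.law _ (φ.measurableSet_fiber y) (hfin y)).const_mul (hmeas y)
    (by positivity) y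
  have hindep : iIndepFun (fun (y : s) ω => (y : ℝ) * M (φ ⁻¹' {(y : ℝ)}) ω) P :=
    (hM.iIndepFun (fun y : s => φ.measurableSet_fiber y) hfin
      ((pairwise_disjoint_fiber φ).comp_of_injective Subtype.val_injective)).comp
        (fun y x => (y : ℝ) * x) fun y => measurable_const_mul _
  have hscale : stableScale α m φ ^ α =
      ∑ y : s, (|(y : ℝ)| * (m (φ ⁻¹' {(y : ℝ)})).toReal ^ (1 / α)) ^ α := by
    rw [stableScale_simpleFunc_rpow hα hφ, ← Finset.sum_coe_sort]
    refine Finset.sum_congr rfl fun y _ => ?_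
    rw [Real.mul_rpow (abs_nonneg _) (by positivity), one_div,
      Real.rpow_inv_rpow ENNReal.toReal_nonneg hα.ne', Measure.real]
  have hsum : simpleStableIntegral M φ = fun ω => ∑ y : s, (y : ℝ) * M (φ ⁻¹' {(y : ℝ)}) ω :=
    funext fun ω => (simpleStableIntegral_eq_sum_ne_zero φ ω).trans
      (Finset.sum_coe_sort s fun y => y * M (φ ⁻¹' {y}) ω).symm
  exact hsum ▸ IsSymmStableLaw.fun_sum hlaw (fun y => (hmeas y).const_mul _) hindep hscale

lemma tendstoInMeasure_simpleStableIntegral_sub [IsProbabilityMeasure P] (hα : 0 < α)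
    (hM : IsSymmStableRandomMeasure α m P M) {ι : Type*} {l : Filter ι} [l.IsCountablyGenerated]
    {φ ψ : ι → SimpleFunc E ℝ} (hφ : ∀ i, (φ i).FinMeasSupp m) (hψ : ∀ i, (ψ i).FinMeasSupp m)
    (h : Tendsto (fun i => eLpNorm (⇑(φ i) - ⇑(ψ i)) (ENNReal.ofReal α) m) l (𝓝 0)) :
    TendstoInMeasure P
      (fun i => simpleStableIntegral M (φ i) - simpleStableIntegral M (ψ i)) l 0 := by
  have hfin (i : ι) := finMeasSupp_smul_add_smul (hφ i) (hψ i) 1 (-1)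
  have hsub (i : ι) : ⇑((1 : ℝ) • φ i + (-1 : ℝ) • ψ i) = ⇑(φ i) - ⇑(ψ i) := by
    ext x
    simp [sub_eq_add_neg]
  have hscale : Tendsto (fun i => stableScale α m ⇑((1 : ℝ) • φ i + (-1 : ℝ) • ψ i)) l (𝓝 0) := by
    simp only [hsub]
    exact (ENNReal.tendsto_toReal ENNReal.zero_ne_top).comp h
  refine (IsSymmStableLaw.tendstoInMeasure_zero hα
    (fun i => (measurable_simpleStableIntegral hM (hfin i)).aemeasurable)
    (fun i => isSymmStableLaw_simpleStableIntegral hα hM (hfin i)) hscale).congr_left fun i => ?_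
  simpa [sub_eq_add_neg] using simpleStableIntegral_smul_add_smul hM (hφ i) (hψ i) 1 (-1)

end SimpleIntegral

section StableIntegral

variable {E Ω : Type*} [MeasurableSpace E] [MeasurableSpace Ω] {α : ℝ} {m : Measure E}
  {P : Measure Ω} {M : Set E → Ω → ℝ} {f g : E → ℝ} {X Y : Ω → ℝ}

lemma isStableIntegral_iff (hα : 0 < α) :
    IsStableIntegral α m P M f X ↔ Measurable X ∧ ∃ φ : ℕ → SimpleFunc E ℝ,
      (∀ n, (φ n).FinMeasSupp m) ∧
      Tendsto (fun n => eLpNorm (⇑(φ n) - f) (ENNReal.ofReal α) m) atTop (𝓝 0) ∧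
      TendstoInMeasure P (fun n => simpleStableIntegral M (φ n)) atTop X := by
  simp only [← tendsto_lintegral_enorm_rpow_zero_iff hα]
  rfl

lemma IsStableIntegral.exists_tendsto_ae (hα : 0 < α) (h : IsStableIntegral α m P M f X) :
    ∃ φ : ℕ → SimpleFunc E ℝ, (∀ n, (φ n).FinMeasSupp m) ∧
      Tendsto (fun n => eLpNorm (⇑(φ n) - f) (ENNReal.ofReal α) m) atTop (𝓝 0) ∧
      ∀ᵐ ω ∂P, Tendsto (fun n => simpleStableIntegral M (φ n) ω) atTop (𝓝 (X ω)) := by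
  obtain ⟨-, φ, hφ, hφf, hφX⟩ := (isStableIntegral_iff hα).1 h
  obtain ⟨ns, hns, hae⟩ := hφX.exists_seq_tendsto_ae
  exact ⟨φ ∘ ns, fun n => hφ _, hφf.comp hns.tendsto_atTop, hae⟩

variable [IsProbabilityMeasure P]

lemma exists_isStableIntegral (hα : 0 < α) (hM : IsSymmStableRandomMeasure α m P M)
    (hf : MemFAlpha α m f) : ∃ X, IsStableIntegral α m P M f X := by
  obtain ⟨φ, hφ, hφf⟩ := hf.exists_simpleFunc_tendsto hα
  have hcauchy : Tendsto (fun p : ℕ × ℕ => eLpNorm (⇑(φ p.1) - ⇑(φ p.2)) (ENNReal.ofReal α) m)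
      atTop (𝓝 0) := by
    have hsub (p : ℕ × ℕ) : ⇑(φ p.1) - ⇑(φ p.2) = (⇑(φ p.1) - f) + (f - ⇑(φ p.2)) :=
      (sub_add_sub_cancel _ _ _).symm
    have hφf' : Tendsto (fun n => eLpNorm (f - ⇑(φ n)) (ENNReal.ofReal α) m) atTop (𝓝 0) :=
      hφf.congr fun n => eLpNorm_sub_comm _ _ _ _
    simp only [hsub, ← prod_atTop_atTop_eq]
    exact tendsto_eLpNorm_add_zero (fun p => ((φ p.1).measurable.sub hf.1).aestronglyMeasurable)
      (fun p => (hf.1.sub (φ p.2).measurable).aestronglyMeasurable)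
      (hφf.comp tendsto_fst) (hφf'.comp tendsto_snd)
  obtain ⟨ns, hns, hconv⟩ := exists_seq_ae_tendsto_of_tendstoInMeasure_sub
    (X := fun n => simpleStableIntegral M (φ n))
    (tendstoInMeasure_simpleStableIntegral_sub hα hM (fun p => hφ p.1) (fun p => hφ p.2) hcauchy)
  have hmeas (k : ℕ) := measurable_simpleStableIntegral hM (hφ (ns k))
  obtain ⟨X, hX, hXlim⟩ := measurable_limit_of_tendsto_metrizable_ae
    (fun k => (hmeas k).aemeasurable) hconv
  exact ⟨X, (isStableIntegral_iff hα).2 ⟨hX, φ ∘ ns, fun k => hφ _, hφf.comp hns.tendsto_atTop,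
    tendstoInMeasure_of_tendsto_ae (fun k => (hmeas k).aestronglyMeasurable) hXlim⟩⟩

lemma isStableIntegral_stableIntegral (hα : 0 < α) (hM : IsSymmStableRandomMeasure α m P M)
    (hf : MemFAlpha α m f) : IsStableIntegral α m P M f (stableIntegral α m P M f) := by
  have h := exists_isStableIntegral hα hM hf
  rw [stableIntegral, dif_pos h]
  exact h.choose_spec

lemma IsStableIntegral.zero (hα : 0 < α) : IsStableIntegral α m P M 0 0 := by
  have hzero : simpleStableIntegral M (0 : SimpleFunc E ℝ) = (0 : Ω → ℝ) := by
    ext ω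
    rw [simpleStableIntegral_eq_sum_ne_zero]
    refine Finset.sum_eq_zero fun y hy => absurd ?_ (Finset.mem_filter.1 hy).2
    obtain ⟨x, hx⟩ := SimpleFunc.mem_range.1 (Finset.mem_filter.1 hy).1
    exact hx.symm
  refine (isStableIntegral_iff hα).2 ⟨measurable_const, fun _ => 0, fun _ => ?_, ?_, ?_⟩
  · simp [SimpleFunc.finMeasSupp_iff_support]
  · simp
  · simp only [hzero]
    exact tendstoInMeasure_of_tendsto_ae
      (fun _ => aestronglyMeasurable_const) (ae_of_all _ fun _ => tendsto_const_nhds)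

lemma IsStableIntegral.smul_add_smul (hα : 0 < α) (hM : IsSymmStableRandomMeasure α m P M)
    (hf : Measurable f) (hg : Measurable g) (hX : IsStableIntegral α m P M f X)
    (hY : IsStableIntegral α m P M g Y) (a b : ℝ) :
    IsStableIntegral α m P M (a • f + b • g) (a • X + b • Y) := by
  obtain ⟨φ, hφ, hφf, hφX⟩ := hX.exists_tendsto_ae hα
  obtain ⟨ψ, hψ, hψg, hψY⟩ := hY.exists_tendsto_ae hα
  have hfin (n : ℕ) := finMeasSupp_smul_add_smul (hφ n) (hψ n) a b
  refine (isStableIntegral_iff hα).2 ⟨(hX.1.const_smul a).add (hY.1.const_smul b),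
    fun n => a • φ n + b • ψ n, hfin, ?_, ?_⟩
  · have hsub (n : ℕ) : ⇑(a • φ n + b • ψ n) - (a • f + b • g) =
        a • (⇑(φ n) - f) + b • (⇑(ψ n) - g) := by
      simp only [SimpleFunc.coe_add, SimpleFunc.coe_smul, smul_sub]
      abel
    simp only [hsub]
    exact tendsto_eLpNorm_add_zero
      (fun n => (((φ n).measurable.sub hf).const_smul a).aestronglyMeasurable)
      (fun n => (((ψ n).measurable.sub hg).const_smul b).aestronglyMeasurable)
      (tendsto_eLpNorm_const_smul_zero a hφf) (tendsto_eLpNorm_const_smul_zero b hψg)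
  · refine tendstoInMeasure_of_tendsto_ae
      (fun n => (measurable_simpleStableIntegral hM (hfin n)).aestronglyMeasurable) ?_
    filter_upwards [hφX, hψY, ae_all_iff.2 fun n =>
      simpleStableIntegral_smul_add_smul hM (hφ n) (hψ n) a b] with ω hωX hωY hω
    simp only [hω]
    exact (hωX.const_smul a).add (hωY.const_smul b)

lemma IsStableIntegral.sum_smul (hα : 0 < α) (hM : IsSymmStableRandomMeasure α m P M) {κ : Type*}
    (s : Finset κ) {f : κ → E → ℝ} {X : κ → Ω → ℝ} (hf : ∀ k, Measurable (f k))
    (hX : ∀ k, IsStableIntegral α m P M (f k) (X k)) (c : κ → ℝ) :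
    IsStableIntegral α m P M (∑ k ∈ s, c k • f k) (∑ k ∈ s, c k • X k) := by
  classical
  induction s using Finset.induction_on with
  | empty => simpa using IsStableIntegral.zero hα
  | insert a s ha ih =>
    simpa [Finset.sum_insert ha] using
      IsStableIntegral.smul_add_smul hα hM (hf a) (by fun_prop) (hX a) ih (c a) 1

theorem IsStableIntegral.isSymmStableLaw (hα : 0 < α) (hM : IsSymmStableRandomMeasure α m P M)
    (hf : MemFAlpha α m f) (hX : IsStableIntegral α m P M f X) :
    IsSymmStableLaw α (stableScale α m f) (P.map X) := by
  obtain ⟨-, φ, hφ, hφf, hφX⟩ := (isStableIntegral_iff hα).1 hX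
  exact IsSymmStableLaw.of_tendstoInMeasure hα
    (fun n => (measurable_simpleStableIntegral hM (hφ n)).aemeasurable)
    (fun n => isSymmStableLaw_simpleStableIntegral hα hM (hφ n))
    (tendsto_stableScale_of_tendsto_eLpNorm_sub hα (fun n => (φ n).measurable) hf hφf) hφX

lemma IsStableIntegral.ae_eq_zero_of_ae_eq_zero (hα : 0 < α)
    (hM : IsSymmStableRandomMeasure α m P M) (hf : MemFAlpha α m f)
    (hX : IsStableIntegral α m P M f X) (h : X =ᵐ[P] 0) : f =ᵐ[m] 0 := by
  have hlaw := hX.isSymmStableLaw hα hM hf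
  rw [Measure.map_congr h] at hlaw
  exact ae_eq_zero_of_stableScale_eq_zero hα hf <|
    hlaw.scale_unique hα.ne' stableScale_nonneg le_rfl (IsSymmStableLaw.zero hα.ne')

theorem tendstoInDistribution_pi_of_tendsto_stableScale (hα : 0 < α)
    (hM : IsSymmStableRandomMeasure α m P M) {E' Ω' : Type*} [MeasurableSpace E']
    [MeasurableSpace Ω'] {m' : Measure E'} {P' : Measure Ω'} [IsProbabilityMeasure P']
    {M' : Set E' → Ω' → ℝ} (hM' : IsSymmStableRandomMeasure α m' P' M') {ι κ : Type*} [Fintype κ]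
    {l : Filter ι} [l.IsCountablyGenerated] {f : ι → κ → E → ℝ} {X : ι → κ → Ω → ℝ}
    {f' : κ → E' → ℝ} {X' : κ → Ω' → ℝ} (hf : ∀ i k, MemFAlpha α m (f i k))
    (hX : ∀ i k, IsStableIntegral α m P M (f i k) (X i k)) (hf' : ∀ k, MemFAlpha α m' (f' k))
    (hX' : ∀ k, IsStableIntegral α m' P' M' (f' k) (X' k))
    (h : ∀ c : κ → ℝ, Tendsto (fun i => stableScale α m (∑ k, c k • f i k)) l
      (𝓝 (stableScale α m' (∑ k, c k • f' k)))) :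
    TendstoInDistribution (fun i ω k => X i k ω) l (fun ω k => X' k ω) (fun _ => P) P' := by
  refine tendstoInDistribution_pi_of_forall_sum fun c => ?_
  have hsum (i : ι) := IsStableIntegral.sum_smul hα hM Finset.univ (fun k => (hf i k).1) (hX i) c
  have hsum' := IsStableIntegral.sum_smul hα hM' Finset.univ (fun k => (hf' k).1) hX' c
  have hlim := IsSymmStableLaw.tendstoInDistribution hα (fun i => (hsum i).1.aemeasurable)
    hsum'.1.aemeasurable
    (fun i => (hsum i).isSymmStableLaw hα hM (MemFAlpha.sum_smul hα _ (hf i) c))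
    (hsum'.isSymmStableLaw hα hM' (MemFAlpha.sum_smul hα _ hf' c)) (h c)
  simpa only [Finset.sum_fn, Pi.smul_apply, smul_eq_mul] using hlim

end StableIntegral

section MovingAverage

variable {α : ℝ}

lemma MemFAlpha.comp_sub_left (hα : 0 < α) {G : Type*} [AddGroup G] [MeasurableSpace G]
    [MeasurableAdd G] [MeasurableNeg G] {μ : Measure G} [μ.IsAddLeftInvariant] [μ.IsNegInvariant]
    {f : G → ℝ} (hf : MemFAlpha α μ f) (u : G) : MemFAlpha α μ fun x => f (u - x) :=
  have hu := Measure.measurePreserving_sub_left μ u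
  (memFAlpha_iff hα).2 ⟨hf.1.comp hu.measurable, (hf.memLp hα).comp_measurePreserving hu⟩

lemma stableScale_comp_sub_left {G : Type*} [AddGroup G] [MeasurableSpace G]
    [MeasurableAdd G] [MeasurableNeg G] {μ : Measure G} [μ.IsAddLeftInvariant] [μ.IsNegInvariant]
    {f : G → ℝ} (hf : Measurable f) (u : G) :
    stableScale α μ (fun x => f (u - x)) = stableScale α μ f :=
  congrArg ENNReal.toReal <|
    eLpNorm_comp_measurePreserving hf.aestronglyMeasurable (Measure.measurePreserving_sub_left μ u)

lemma stableScale_comp_mul_left (hα : 0 < α) (f : ℝ → ℝ) {r : ℝ} (hr : r ≠ 0) :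
    stableScale α volume (fun x => f (r * x)) = |r| ^ (-(1 / α)) * stableScale α volume f := by
  rw [stableScale, eLpNorm_comp_mul_left ENNReal.ofReal_ne_top f hr, ENNReal.toReal_mul,
    ← ENNReal.toReal_rpow, ENNReal.toReal_ofReal (abs_nonneg _), abs_inv,
    Real.inv_rpow (abs_nonneg r), ← Real.rpow_neg (abs_nonneg r), ENNReal.toReal_div,
    ENNReal.toReal_ofReal hα.le, ENNReal.toReal_one, stableScale]

/-- The kernel of `r^{-H} (Y(u + r t) - Y(u))`, where `Y` is the moving average with kernel
`g`. -/
noncomputable def incrementKernel (H : ℝ) (g : ℝ → ℝ) (u r t : ℝ) : ℝ → ℝ :=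
  r ^ (-H) • (fun x => g (u + r * t - x)) + (-r ^ (-H)) • fun x => g (u - x)

/-- The increments of `g` at the origin on scale `r`, normalised by `r^γ`. Their limit as
`r → 0⁺` is the kernel of the tangent process. -/
noncomputable def scaledIncrement (γ : ℝ) (g : ℝ → ℝ) (r t z : ℝ) : ℝ :=
  (g (r * (t + z)) - g (r * z)) / r ^ γ

variable {g : ℝ → ℝ}

lemma MemFAlpha.incrementKernel (hα : 0 < α) (hg : MemFAlpha α volume g) (H u r t : ℝ) :
    MemFAlpha α volume (incrementKernel H g u r t) :=
  (hg.comp_sub_left hα _).smul_add_smul hα (hg.comp_sub_left hα _) _ _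

lemma measurable_scaledIncrement (hg : Measurable g) (γ r t : ℝ) :
    Measurable (scaledIncrement γ g r t) := by
  unfold scaledIncrement
  fun_prop

lemma stableScale_sum_incrementKernel (hα : 0 < α) (hg : Measurable g) {κ : Type*} (s : Finset κ)
    (c t : κ → ℝ) (γ u : ℝ) {r : ℝ} (hr : 0 < r) :
    stableScale α volume (∑ k ∈ s, c k • incrementKernel (γ + 1 / α) g u r (t k)) =
      stableScale α volume (∑ k ∈ s, c k • scaledIncrement γ g r (t k)) := by
  let G : ℝ → ℝ := fun y => ∑ k ∈ s, c k * (g (y + r * t k) - g y)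
  have hG : Measurable G := by fun_prop
  have hkernel : ∑ k ∈ s, c k • incrementKernel (γ + 1 / α) g u r (t k) =
      r ^ (-(γ + 1 / α)) • fun x => G (u - x) := by
    ext x
    simp only [incrementKernel, G, Finset.sum_apply, Pi.smul_apply, Pi.add_apply, smul_eq_mul,
      Finset.mul_sum, add_sub_right_comm u]
    exact Finset.sum_congr rfl fun k _ => by ring
  have hincrement : ∑ k ∈ s, c k • scaledIncrement γ g r (t k) =
      r ^ (-γ) • fun z => G (r * z) := by
    ext z
    simp only [scaledIncrement, G, Finset.sum_apply, Pi.smul_apply, smul_eq_mul, Finset.mul_sum,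
      Real.rpow_neg hr.le, mul_add, add_comm (r * z)]
    exact Finset.sum_congr rfl fun k _ => by ring
  rw [hkernel, hincrement, stableScale_const_smul, stableScale_const_smul,
    stableScale_comp_sub_left hG, stableScale_comp_mul_left hα G hr.ne', abs_of_pos hr,
    abs_of_pos (by positivity), abs_of_pos (by positivity), ← mul_assoc, ← Real.rpow_add hr,
    neg_add]

lemma tendsto_stableScale_sum_incrementKernel (hα : 0 < α) (hg : Measurable g) {γ : ℝ}
    {h : ℝ → ℝ → ℝ} (h_mem : ∀ t, MemFAlpha α volume (h t))
    (h_lim : ∀ t, Tendsto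
      (fun r => eLpNorm (scaledIncrement γ g r t - h t) (ENNReal.ofReal α) volume) (𝓝[>] 0) (𝓝 0))
    (u : ℝ) {κ : Type*} (s : Finset κ) (c t : κ → ℝ) :
    Tendsto (fun r => stableScale α volume
        (∑ k ∈ s, c k • incrementKernel (γ + 1 / α) g u r (t k))) (𝓝[>] 0)
      (𝓝 (stableScale α volume (∑ k ∈ s, c k • h (t k)))) := by
  have hmeas (r t : ℝ) := measurable_scaledIncrement hg γ r t
  have hdiff : Tendsto (fun r => eLpNorm ((∑ k ∈ s, c k • scaledIncrement γ g r (t k)) -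
      ∑ k ∈ s, c k • h (t k)) (ENNReal.ofReal α) volume) (𝓝[>] 0) (𝓝 0) := by
    simp only [← Finset.sum_sub_distrib, ← smul_sub]
    exact tendsto_eLpNorm_sum_zero s
      (fun k r => (((hmeas r (t k)).sub (h_mem (t k)).1).const_smul (c k)).aestronglyMeasurable)
      fun k => tendsto_eLpNorm_const_smul_zero (c k) (h_lim (t k))
  refine (tendsto_stableScale_of_tendsto_eLpNorm_sub hα (fun r => by fun_prop)
    (MemFAlpha.sum_smul hα s (fun k => h_mem (t k)) c) hdiff).congr' ?_
  filter_upwards [self_mem_nhdsWithin] with r hr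
  exact (stableScale_sum_incrementKernel hα hg s c t γ u hr).symm

end MovingAverage

theorem proposition2p1_general {Ω Ω' : Type*} [MeasurableSpace Ω] [MeasurableSpace Ω']
    (P : Measure Ω) [IsProbabilityMeasure P] (P' : Measure Ω') [IsProbabilityMeasure P']
    {α : ℝ} (hα : 0 < α) {M : Set ℝ → Ω → ℝ} (hM : IsSymmStableRandomMeasure α volume P M)
    {M' : Set ℝ → Ω' → ℝ} (hM' : IsSymmStableRandomMeasure α volume P' M')
    {g : ℝ → ℝ} (hg : MemFAlpha α volume g) {Y : ℝ → Ω → ℝ}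
    (hY : ∀ t, Y t =ᵐ[P] stableIntegral α volume P M fun x => g (t - x))
    {γ : ℝ} (hγ : 0 < γ + 1 / α) {h : ℝ → ℝ → ℝ} (h_mem : ∀ t, MemFAlpha α volume (h t))
    (h_nontrivial : ∃ t, ¬ h t =ᵐ[volume] 0)
    (h_lim : ∀ t, Tendsto (fun r => ∫⁻ z, ‖(g (r * (t + z)) - g (r * z)) / r ^ γ - h t z‖ₑ ^ α)
      (𝓝[>] 0) (𝓝 0)) (u : ℝ) :
    IsLocalisableAt P P' (γ + 1 / α) Y u fun t => stableIntegral α volume P' M' (h t) := by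
  have hY_int (t : ℝ) := isStableIntegral_stableIntegral hα hM (hg.comp_sub_left hα t)
  have hZ_int (t : ℝ) := isStableIntegral_stableIntegral hα hM' (h_mem t)
  refine ⟨hγ, ?_, fun n t => ?_⟩
  · obtain ⟨t, ht⟩ := h_nontrivial
    exact ⟨t, mt ((hZ_int t).ae_eq_zero_of_ae_eq_zero hα hM' (h_mem t)) ht⟩
  refine (tendstoInDistribution_pi_of_tendsto_stableScale hα hM hM'
    (fun r i => hg.incrementKernel hα (γ + 1 / α) u r (t i))
    (fun r i => (hY_int (u + r * t i)).smul_add_smul hα hM (hg.comp_sub_left hα _).1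
      (hg.comp_sub_left hα _).1 (hY_int u) _ _)
    (fun i => h_mem (t i)) (fun i => hZ_int (t i))
    fun c => tendsto_stableScale_sum_incrementKernel hα hg.1 h_mem
      (fun t => (tendsto_lintegral_enorm_rpow_zero_iff hα).1 (h_lim t)) u Finset.univ c t).congr
    (fun r => ?_) .rfl
  filter_upwards [ae_all_iff.2 fun i => hY (u + r * t i), hY u] with ω hω_rt hω_u
  ext i
  simp only [hω_rt, hω_u, Pi.add_apply, Pi.smul_apply, smul_eq_mul]
  ring

theorem proposition2p1 {Ω : Type*} [MeasurableSpace Ω] (P : Measure Ω) [IsProbabilityMeasure P]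
    (α : ℝ) (hα0 : 0 < α) (hα2 : α ≤ 2)
    (M : Set ℝ → Ω → ℝ) (hM : IsSymmStableRandomMeasure α (volume : Measure ℝ) P M)
    (g : ℝ → ℝ) (hg : MemFAlpha α (volume : Measure ℝ) g)
    (Y : ℝ → Ω → ℝ)
    (hY : ∀ t : ℝ, Y t =ᵐ[P] stableIntegral α (volume : Measure ℝ) P M (fun x => g (t - x)))
    (γ : ℝ) (hγ : 0 < γ + 1 / α)
    (h : ℝ → ℝ → ℝ) (h_meas : Measurable (Function.uncurry h))
    (h_mem : ∀ t : ℝ, MemFAlpha α (volume : Measure ℝ) (h t))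
    (h_nontrivial : ∃ t : ℝ, ¬ (h t =ᵐ[(volume : Measure ℝ)] 0))
    (h_lim : ∀ t : ℝ,
      Tendsto (fun r : ℝ => ∫⁻ z : ℝ, ‖(g (r * (t + z)) - g (r * z)) / r ^ γ - h t z‖ₑ ^ α)
        (𝓝[>] (0 : ℝ)) (𝓝 0)) :
    ∀ u : ℝ, IsLocalisableAt P P (γ + 1 / α) Y u
      (fun t => stableIntegral α (volume : Measure ℝ) P M (h t)) :=
  proposition2p1_general P P hα0 hM hM hg hY hγ h_mem h_nontrivial h_lim
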